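/- Let $E$ be a Hilbert $C^*$-module over a $C^*$-algebra $A$, let $L(E)$ be the algebra of bounded adjointable operators on $E$, and let $K(E)\subseteq L(E)$ be the norm-closed linear span of the operators $z\mapsto x\langle y,z\rangle$, $x,y\in E$. A closed, densely defined, $A$-linear operator $t: D(t)\subseteq E\to E$ with densely defined adjoint $t^*$ is called *regular* if $I+t^*t$ has dense range, and a regular operator $t$ is *selfadjoint* if $t=t^*$. A regular operator $t$ is *Fredholm* if there are $G,G'\in L(E)$ such that $Gt$ and $tG'$ are closable and their closures belong to $L(E)$ and are congruent to $1$ modulo $K(E)$. The graph $G(t)=\{(x,tx):x\in D(t)\}$ of a regular operator $t$ is orthogonally complemented in $E\oplus E$; let $P_{G(t)}$ be the orthogonal projection onto it. The gap metric is defined by $g(s,t)=\|P_{G(s)}-P_{G(t)}\|$ for regular operators $s,t$ on $E$. **Theorem.** Let $t$ be a selfadjoint regular Fredholm operator on a Hilbert $C^*$-module $E$. Then there exists $r>0$ such that every selfadjoint regular operator $s$ on $E$ with $g(s,t)\le r$ is Fredholm. -/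

import Mathlib

namespace HilbertModule

open Topology

/-! Throughout, `E` is a Hilbert C*-module over the (not necessarily unital) C*-algebra `A`: a
complete `CStarModule A E`. The module action is written on the left and the inner product
`inner A x y` is linear in `y`; right modules over `B` are the case `A = Bᵐᵒᵖ`. -/

set_option linter.unusedSectionVars false

section Bounded

variable (A : Type*) {E : Type*} [NonUnitalCStarAlgebra A] [PartialOrder A] [StarOrderedRing A]
  [NormedAddCommGroup E] [NormedSpace ℂ E] [SMul A E] [CStarModule A E]

/-- `T` belongs to `L(E)`: it is a (bounded) operator that possesses an adjoint. -/
def IsAdjointable (T : E →L[ℂ] E) : Prop :=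
  ∃ S : E →L[ℂ] E, ∀ x y : E, inner A (T x) y = inner A x (S y)

theorem ext_inner {x y : E} (h : ∀ z : E, inner A z x = inner A z y) : x = y := by
  rw [← sub_eq_zero, ← CStarModule.inner_self (A := A), CStarModule.inner_sub_right, h, sub_self]

/-- The elementary operator `θ_{x,y} : z ↦ x ⟨y, z⟩`. -/
noncomputable def rankOne (x y : E) : E →L[ℂ] E :=
  LinearMap.mkContinuous
    { toFun := fun z => (inner A y z : A) • x
      map_add' := fun z w => by
        refine ext_inner A fun v => ?_
        simp [add_mul]
      map_smul' := fun c z => by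
        refine ext_inner A fun v => ?_
        simp [smul_mul_assoc] }
    (‖x‖ * ‖y‖) (fun z => by
      have h1 : ‖(inner A y z : A) • x‖ ^ 2 ≤ (‖x‖ * ‖y‖ * ‖z‖) ^ 2 := by
        have h2 : ‖(inner A y z : A)‖ ≤ ‖y‖ * ‖z‖ := CStarModule.norm_inner_le E
        rw [CStarModule.norm_sq_eq A, CStarModule.inner_op_smul_right,
          CStarModule.inner_op_smul_left]
        calc _ ≤ ‖(inner A y z : A)‖ * (‖(inner A x x : A)‖ * ‖star (inner A y z : A)‖) :=
              (norm_mul_le _ _).trans (by gcongr; exact norm_mul_le _ _)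
          _ = ‖(inner A y z : A)‖ ^ 2 * ‖x‖ ^ 2 := by
              rw [norm_star, CStarModule.norm_sq_eq A (x := x)]; ring
          _ ≤ (‖y‖ * ‖z‖) ^ 2 * ‖x‖ ^ 2 := by gcongr
          _ = _ := by ring
      exact (sq_le_sq₀ (norm_nonneg _) (by positivity)).1 h1)

/-- `K(E)`: the operator-norm closed linear span of the operators `θ_{x,y}`. -/
noncomputable def compactOperators : Submodule ℂ (E →L[ℂ] E) :=
  (Submodule.span ℂ (Set.range fun p : E × E => rankOne A p.1 p.2)).topologicalClosure

/-- `P` is the orthogonal projection onto the submodule `M`: a selfadjoint idempotent with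
range `M`. -/
structure IsOrthogonalProjection (P : E →L[ℂ] E) (M : Submodule ℂ E) : Prop where
  symm : ∀ x y : E, inner A (P x) y = inner A x (P y)
  idem : ∀ x : E, P (P x) = P x
  range_eq : LinearMap.range (P : E →ₗ[ℂ] E) = M

end Bounded

section Unbounded

variable {E : Type*} [NormedAddCommGroup E] [NormedSpace ℂ E]

/-- An everywhere defined operator as a partially defined one. -/
def ofBounded (T : E →L[ℂ] E) : E →ₗ.[ℂ] E := (T : E →ₗ[ℂ] E).toPMap ⊤

/-- The product `g f` of unbounded operators, with domain `{x ∈ D(f) : f x ∈ D(g)}`. -/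
def prod (g f : E →ₗ.[ℂ] E) : E →ₗ.[ℂ] E where
  domain :=
    { carrier := {x | ∃ h : x ∈ f.domain, f ⟨x, h⟩ ∈ g.domain}
      add_mem' := by
        rintro x y ⟨hx, hx'⟩ ⟨hy, hy'⟩
        refine ⟨f.domain.add_mem hx hy, ?_⟩
        have : f ⟨x + y, f.domain.add_mem hx hy⟩ = f ⟨x, hx⟩ + f ⟨y, hy⟩ :=
          f.map_add ⟨x, hx⟩ ⟨y, hy⟩
        rw [this]
        exact g.domain.add_mem hx' hy'
      zero_mem' := ⟨f.domain.zero_mem, by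
        have : f ⟨0, f.domain.zero_mem⟩ = 0 := f.map_zero
        rw [this]
        exact g.domain.zero_mem⟩
      smul_mem' := by
        rintro c x ⟨hx, hx'⟩
        refine ⟨f.domain.smul_mem c hx, ?_⟩
        have : f ⟨c • x, f.domain.smul_mem c hx⟩ = c • f ⟨x, hx⟩ := f.map_smul c ⟨x, hx⟩
        rw [this]
        exact g.domain.smul_mem c hx' }
  toFun :=
    { toFun := fun x => g ⟨f ⟨x.1, x.2.1⟩, x.2.2⟩
      map_add' := fun x y => by
        rw [← g.map_add]
        congr 1
        exact Subtype.ext (f.map_add ⟨x.1, x.2.1⟩ ⟨y.1, y.2.1⟩)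
      map_smul' := fun c x => by
        rw [RingHom.id_apply, ← g.map_smul]
        congr 1
        exact Subtype.ext (f.map_smul c ⟨x.1, x.2.1⟩) }

variable (A : Type*) [NonUnitalCStarAlgebra A] [PartialOrder A] [StarOrderedRing A]
  [SMul A E] [CStarModule A E]

/-- The set of all pairs `(y, z)` with `⟨t x, y⟩ = ⟨x, z⟩` for all `x ∈ D(t)`. -/
def adjointGraph (t : E →ₗ.[ℂ] E) : Submodule ℂ (E × E) where
  carrier := {p | ∀ x : t.domain, inner A (t x) p.1 = inner A (x : E) p.2}
  add_mem' := fun hp hq x => by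
    rw [Prod.fst_add, Prod.snd_add, CStarModule.inner_add_right, CStarModule.inner_add_right,
      hp x, hq x]
  zero_mem' := fun x => by simp
  smul_mem' := fun c p hp x => by
    rw [Prod.smul_fst, Prod.smul_snd, CStarModule.inner_smul_right_complex,
      CStarModule.inner_smul_right_complex, hp x]

/-- The adjoint `t*` of a densely defined operator `t`: the operator with graph
`adjointGraph A t` (which is a graph as soon as `t` is densely defined). -/
noncomputable def adjoint (t : E →ₗ.[ℂ] E) : E →ₗ.[ℂ] E := (adjointGraph A t).toLinearPMap

/-- Regular operators: closed, densely defined, `A`-linear operators with densely defined adjoint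
such that `1 + t* t` has dense range. -/
structure IsRegular (t : E →ₗ.[ℂ] E) : Prop where
  smul_mem : ∀ (a : A) {x : E}, x ∈ t.domain → a • x ∈ t.domain
  map_smul : ∀ (a : A) (x : t.domain), t ⟨a • (x : E), smul_mem a x.2⟩ = a • t x
  closed : t.IsClosed
  dense_domain : Dense (t.domain : Set E)
  dense_adjoint_domain : Dense ((adjoint A t).domain : Set E)
  dense_range : Dense (Set.range fun x : (prod (adjoint A t) t).domain =>
    (x : E) + prod (adjoint A t) t x)

/-- `t = t*`. -/
def IsSelfadjoint (t : E →ₗ.[ℂ] E) : Prop := adjoint A t = t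

/-- The operator `u` is closable, its closure is everywhere defined and belongs to `L(E)`, and the
closure is congruent to `1` modulo `K(E)`. -/
def ClosureEqOneModCompact (u : E →ₗ.[ℂ] E) : Prop :=
  u.IsClosable ∧ ∃ T : E →L[ℂ] E, IsAdjointable A T ∧ u.closure = ofBounded T ∧
    T - 1 ∈ compactOperators A (E := E)

/-- `G ∈ L(E)` is a pseudo left inverse of `t`. -/
def IsPseudoLeftInverse (G : E →L[ℂ] E) (t : E →ₗ.[ℂ] E) : Prop :=
  IsAdjointable A G ∧ ClosureEqOneModCompact A (prod (ofBounded G) t)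

/-- `G ∈ L(E)` is a pseudo right inverse of `t`. -/
def IsPseudoRightInverse (G : E →L[ℂ] E) (t : E →ₗ.[ℂ] E) : Prop :=
  IsAdjointable A G ∧ ClosureEqOneModCompact A (prod t (ofBounded G))

/-- A regular operator is Fredholm if it has a pseudo left inverse and a pseudo right inverse. -/
def IsFredholm (t : E →ₗ.[ℂ] E) : Prop :=
  (∃ G : E →L[ℂ] E, IsPseudoLeftInverse A G t) ∧ ∃ G : E →L[ℂ] E, IsPseudoRightInverse A G t

/-- The graph of `t` as a subspace of the Hilbert C*-module `E ⊕ E`, which is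
`WithCStarModule A (E × E)` with `⟨(x, y), (x', y')⟩ = ⟨x, x'⟩ + ⟨y, y'⟩`. -/
def graph (t : E →ₗ.[ℂ] E) : Submodule ℂ (WithCStarModule A (E × E)) :=
  t.graph.comap (WithCStarModule.linearEquiv ℂ A (E × E) : _ →ₗ[ℂ] E × E)

end Unbounded

section GraphProjection

variable {A E : Type*} [NonUnitalCStarAlgebra A] [PartialOrder A] [StarOrderedRing A]
  [NormedAddCommGroup E] [NormedSpace ℂ E] [SMul A E] [CStarModule A E]

theorem norm_le_of_inner_eq_zero {p q : E} (h : inner A p q = 0) : ‖p‖ ≤ ‖p + q‖ := by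
  have h' : inner A q p = 0 := by rw [← CStarModule.star_inner, h, star_zero]
  have h1 : (inner A p p : A) ≤ inner A (p + q) (p + q) := by
    simp only [CStarModule.inner_add_left, CStarModule.inner_add_right, h, h', add_zero, zero_add]
    exact le_add_of_nonneg_right CStarModule.inner_self_nonneg
  rw [CStarModule.norm_eq_sqrt_norm_inner_self (A := A) p,
    CStarModule.norm_eq_sqrt_norm_inner_self (A := A) (p + q)]
  exact Real.sqrt_le_sqrt
    (CStarAlgebra.norm_le_norm_of_nonneg_of_le CStarModule.inner_self_nonneg h1)

/-- A closed submodule `M` with `M + M^⊥` dense is the range of an orthogonal projection. -/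
theorem exists_isOrthogonalProjection [CompleteSpace E] (M : Submodule ℂ E)
    (hM : IsClosed (M : Set E))
    (hd : Dense {z : E | ∃ p ∈ M, ∀ m ∈ M, inner A m (z - p) = 0}) :
    ∃ P : E →L[ℂ] E, IsOrthogonalProjection A P M := by
  have key : ∀ z : E, ∃ p ∈ M, ∀ m ∈ M, inner A m (z - p) = 0 := by
    intro z
    obtain ⟨u, hu, hlim⟩ := mem_closure_iff_seq_limit.1 (hd z)
    choose p hp ho using hu
    have hdist : ∀ m n, dist (p m) (p n) ≤ dist (u m) (u n) := by
      intro m n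
      have h0 : inner A (p m - p n) ((u m - p m) - (u n - p n)) = 0 := by
        rw [CStarModule.inner_sub_right, ho m _ (M.sub_mem (hp m) (hp n)),
          ho n _ (M.sub_mem (hp m) (hp n)), sub_zero]
      have h1 := norm_le_of_inner_eq_zero h0
      rw [dist_eq_norm, dist_eq_norm]
      have h2 : (p m - p n) + ((u m - p m) - (u n - p n)) = u m - u n := by abel
      rwa [h2] at h1
    have hc : CauchySeq p := by
      have := hlim.cauchySeq
      rw [Metric.cauchySeq_iff] at this ⊢
      intro ε hε
      obtain ⟨N, hN⟩ := this ε hε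
      exact ⟨N, fun m hm n hn => (hdist m n).trans_lt (hN m hm n hn)⟩
    obtain ⟨q, hq⟩ := cauchySeq_tendsto_of_complete hc
    refine ⟨q, hM.mem_of_tendsto hq (Filter.Eventually.of_forall hp), fun m hm => ?_⟩
    have hl : Filter.Tendsto (fun n => (CStarModule.innerSL (A := A) m) (u n - p n)) Filter.atTop
        (𝓝 ((CStarModule.innerSL (A := A) m) (z - q))) :=
      ((CStarModule.innerSL (A := A) m).continuous.tendsto _).comp (hlim.sub hq)
    have hz : (fun n => (CStarModule.innerSL (A := A) m) (u n - p n)) = fun _ => (0 : A) :=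
      funext fun n => ho n m hm
    rw [hz] at hl
    exact (tendsto_nhds_unique tendsto_const_nhds hl).symm
  choose P hP ho using key
  have uniq : ∀ z p, p ∈ M → (∀ m ∈ M, inner A m (z - p) = 0) → P z = p := by
    intro z p hp h
    rw [← sub_eq_zero, ← CStarModule.inner_self (A := A)]
    have e : P z - p = (z - p) - (z - P z) := by abel
    have hm := M.sub_mem (hP z) hp
    have h1 : inner A (P z - p) ((z - p) - (z - P z)) = 0 := by
      rw [CStarModule.inner_sub_right, h _ hm, ho z _ hm, sub_zero]
    rwa [← e] at h1
  let L : E →ₗ[ℂ] E :=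
    { toFun := P
      map_add' := fun x y => uniq _ _ (M.add_mem (hP x) (hP y)) fun m hm => by
        rw [add_sub_add_comm, CStarModule.inner_add_right, ho x m hm, ho y m hm, add_zero]
      map_smul' := fun c x => uniq _ _ (M.smul_mem c (hP x)) fun m hm => by
        rw [RingHom.id_apply, ← smul_sub, CStarModule.inner_smul_right_complex, ho x m hm,
          smul_zero] }
  have hbound : ∀ x, ‖L x‖ ≤ 1 * ‖x‖ := fun x => by
    have := norm_le_of_inner_eq_zero (ho x (P x) (hP x))
    rwa [add_sub_cancel, ← one_mul ‖x‖] at this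
  have hfix : ∀ x ∈ M, P x = x := fun x hx => uniq _ _ hx fun m _ => by simp
  have hsym : ∀ x y, (inner A (P x) y : A) = inner A (P x) (P y) := fun x y => by
    have := ho y (P x) (hP x)
    rwa [CStarModule.inner_sub_right, sub_eq_zero] at this
  refine ⟨L.mkContinuous 1 hbound, ⟨fun x y => ?_, fun x => hfix _ (hP x), ?_⟩⟩
  · change (inner A (P x) y : A) = inner A x (P y)
    have h1 := congrArg star (hsym y x)
    rw [CStarModule.star_inner, CStarModule.star_inner] at h1
    exact (hsym x y).trans h1.symm
  · ext y
    refine ⟨?_, fun hy => ⟨y, hfix y hy⟩⟩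
    rintro ⟨x, rfl⟩
    exact hP x

/-- The orthogonal projection onto `M` is unique. -/
theorem IsOrthogonalProjection.unique {P Q : E →L[ℂ] E} {M : Submodule ℂ E} (hP : IsOrthogonalProjection A P M)
    (hQ : IsOrthogonalProjection A Q M) : P = Q := by
  have f1 : ∀ x, Q (P x) = P x := fun x => by
    have : P x ∈ M := by rw [← hP.range_eq]; exact ⟨x, rfl⟩
    rw [← hQ.range_eq] at this
    obtain ⟨y, hy⟩ := this
    have hy : Q y = P x := hy
    rw [← hy, hQ.idem]
  have f2 : ∀ x, P (Q x) = Q x := fun x => by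
    have : Q x ∈ M := by rw [← hQ.range_eq]; exact ⟨x, rfl⟩
    rw [← hP.range_eq] at this
    obtain ⟨y, hy⟩ := this
    have hy : P y = Q x := hy
    rw [← hy, hP.idem]
  ext x
  apply ext_inner A
  intro z
  rw [← f1, ← hQ.symm, ← f2, hP.symm, hP.idem, ← hP.symm, f2, hQ.symm]

theorem mem_adjointGraph_of_mem_domain {t : E →ₗ.[ℂ] E} (hd : Dense (t.domain : Set E))
    (y : (adjoint A t).domain) : ((y : E), adjoint A t y) ∈ adjointGraph A t := by
  refine (adjointGraph A t).mem_graph_toLinearPMap ?_ y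
  rintro ⟨a, b⟩ h (rfl : a = 0)
  have h0 : ∀ x ∈ (t.domain : Set E), (CStarModule.innerSL (A := A) b) x = 0 := fun x hx => by
    have := h ⟨x, hx⟩
    simp only [CStarModule.inner_zero_right] at this
    rw [CStarModule.innerSL_apply, ← CStarModule.star_inner, ← this, star_zero]
  have h1 : (CStarModule.innerSL (A := A) b : E → A) = fun _ => 0 :=
    Continuous.ext_on hd (CStarModule.innerSL (A := A) b).continuous continuous_const h0
  have := congrFun h1 b
  rwa [CStarModule.innerSL_apply, CStarModule.inner_self] at this

/-- The graph of a regular operator is orthogonally complemented in `E ⊕ E`. -/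
theorem IsRegular.exists_graphProjection [CompleteSpace E] {t : E →ₗ.[ℂ] E}
    (ht : IsRegular A t) :
    ∃ P : WithCStarModule A (E × E) →L[ℂ] WithCStarModule A (E × E),
      IsOrthogonalProjection A P (graph A t) := by
  let e := WithCStarModule.equivL ℂ (A := A) (E := E × E)
  refine exists_isOrthogonalProjection _ (ht.closed.preimage e.continuous) ?_
  have hS : Dense {z : E × E | ∃ p ∈ graph A t, ∀ m ∈ graph A t, inner A m (e.symm z - p) = 0} := by
    have hdom : Dense {z : E × E | z.2 ∈ ((adjoint A t).domain : Set E)} := by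
      have := dense_univ.prod (X := E) ht.dense_adjoint_domain
      rwa [Set.univ_prod] at this
    rw [dense_iff_inter_open]
    intro U hU hne
    obtain ⟨⟨u, v⟩, hzU, hv⟩ := hdom.inter_open_nonempty U hU hne
    have hV : IsOpen {r : E | ((r - adjoint A t ⟨v, hv⟩, v) : E × E) ∈ U} :=
      hU.preimage (by fun_prop)
    obtain ⟨_, hrU, ⟨x, rfl⟩⟩ := ht.dense_range.inter_open_nonempty _ hV
      ⟨u + adjoint A t ⟨v, hv⟩, by simpa using hzU⟩
    refine ⟨_, hrU, e.symm ((x : E), t ⟨x.1, x.2.1⟩), ?_, ?_⟩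
    · exact t.mem_graph ⟨x.1, x.2.1⟩
    · intro m hm
      obtain ⟨w, hw1, hw2⟩ := t.mem_graph_iff.1 hm
      have h1 := mem_adjointGraph_of_mem_domain ht.dense_domain ⟨v, hv⟩ w
      have h2 := mem_adjointGraph_of_mem_domain ht.dense_domain ⟨_, x.2.2⟩ w
      change inner A m.1 ((x : E) + adjoint A t ⟨_, x.2.2⟩ - adjoint A t ⟨v, hv⟩ - (x : E)) +
        inner A m.2 (v - t ⟨x.1, x.2.1⟩) = 0
      have hw1' : m.1 = w := hw1.symm
      have hw2' : m.2 = t w := hw2.symm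
      simp only at h1 h2
      rw [hw1', hw2']
      simp only [CStarModule.inner_sub_right, CStarModule.inner_add_right, h1, h2]
      abel
  exact hS.preimage e.toHomeomorph.isOpenMap

/-- `P_{G(t)}`, the orthogonal projection of `E ⊕ E` onto the graph of the regular operator `t`. -/
noncomputable def graphProjection [CompleteSpace E] {t : E →ₗ.[ℂ] E} (ht : IsRegular A t) :
    WithCStarModule A (E × E) →L[ℂ] WithCStarModule A (E × E) :=
  ht.exists_graphProjection.choose

/-- The gap metric `g(s, t) = ‖P_{G(s)} - P_{G(t)}‖` on regular operators. -/
noncomputable def gap [CompleteSpace E] {s t : E →ₗ.[ℂ] E} (hs : IsRegular A s)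
    (ht : IsRegular A t) : ℝ :=
  ‖graphProjection hs - graphProjection ht‖

end GraphProjection

end HilbertModule

namespace HilbertModule

open Topology Complex

set_option linter.unusedSectionVars false

/-! ### Adjointable operators and the ideal of compact operators. -/

section BoundedLemmas

variable {A E : Type*} [NonUnitalCStarAlgebra A] [PartialOrder A] [StarOrderedRing A]
  [NormedAddCommGroup E] [NormedSpace ℂ E] [SMul A E] [CStarModule A E]

/-! The Fredholm property of a selfadjoint regular `s` is read off a bounded operator, `B_s = s (s +
i)⁻¹ = 1 - i (s + i)⁻¹`: `s` is Fredholm exactly when `B_s` has left and right inverses modulo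
`K(E)` in `L(E)`.

The resolvent is a combination of two entries of `P_{G(s)}`, so `s ↦ B_s` is Lipschitz for the gap
metric (`norm_resolvent_sub_le`). One-sided invertibility modulo the ideal `K(E)` survives small
perturbations, by a Neumann series inside `L(E)` (`exists_left_inverse_of_norm_sub_lt` and its
mirror image). Hence inverses of `B_t` modulo `K(E)` yield such inverses of `B_s`, which convert
back to pseudo inverses of `s`. -/

theorem ext_inner_left {x y : E} (h : ∀ z : E, (inner A x z : A) = inner A y z) : x = y :=
  ext_inner A fun z => by
    rw [← CStarModule.star_inner x z, ← CStarModule.star_inner y z, h]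

theorem eq_of_inner_eq_on_dense {D : Set E} (hD : Dense D) {x y : E}
    (h : ∀ z ∈ D, (inner A z x : A) = inner A z y) : x = y := by
  refine ext_inner_left (A := A) fun z => ?_
  have h1 : (CStarModule.innerSL (A := A) x : E → A) = CStarModule.innerSL (A := A) y :=
    Continuous.ext_on hD (CStarModule.innerSL (A := A) x).continuous
      (CStarModule.innerSL (A := A) y).continuous fun w hw => by
        rw [CStarModule.innerSL_apply, CStarModule.innerSL_apply, ← CStarModule.star_inner w x,
          ← CStarModule.star_inner w y, h w hw]
  exact congrFun h1 z

theorem rankOne_apply (x y z : E) : rankOne A x y z = (inner A y z : A) • x := rfl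

theorem isAdjointable_one : IsAdjointable A (1 : E →L[ℂ] E) := ⟨1, fun _ _ => rfl⟩

theorem IsAdjointable.add {S T : E →L[ℂ] E} (hS : IsAdjointable A S) (hT : IsAdjointable A T) :
    IsAdjointable A (S + T) := by
  obtain ⟨S', hS⟩ := hS
  obtain ⟨T', hT⟩ := hT
  exact ⟨S' + T', fun x y => by simp [CStarModule.inner_add_left, hS, hT]⟩

theorem IsAdjointable.smul {T : E →L[ℂ] E} (hT : IsAdjointable A T) (c : ℂ) :
    IsAdjointable A (c • T) := by
  obtain ⟨T', hT⟩ := hT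
  exact ⟨star c • T', fun x y => by simp [hT, CStarModule.inner_smul_left_complex]⟩

theorem IsAdjointable.sub {S T : E →L[ℂ] E} (hS : IsAdjointable A S) (hT : IsAdjointable A T) :
    IsAdjointable A (S - T) := by
  simpa [sub_eq_add_neg] using hS.add (hT.smul (-1))

theorem IsAdjointable.mul {S T : E →L[ℂ] E} (hS : IsAdjointable A S) (hT : IsAdjointable A T) :
    IsAdjointable A (S * T) := by
  obtain ⟨S', hS⟩ := hS
  obtain ⟨T', hT⟩ := hT
  exact ⟨T' * S', fun x y => by simp [hS, hT]⟩

/-- Testing the adjoint relation on `S y` bounds `‖S y‖²` by `‖T (S y)‖ ‖y‖`. The bound lets the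
Neumann series of the adjoint converge along with that of `T`. -/
theorem norm_adjoint_le {T S : E →L[ℂ] E}
    (h : ∀ x y : E, (inner A (T x) y : A) = inner A x (S y)) : ‖S‖ ≤ ‖T‖ := by
  refine S.opNorm_le_bound (norm_nonneg _) fun y => ?_
  rcases (norm_nonneg (S y)).eq_or_lt with h0 | h0
  · rw [← h0]; positivity
  · refine le_of_mul_le_mul_right ?_ h0
    calc ‖S y‖ * ‖S y‖ = ‖(inner A (S y) (S y) : A)‖ := by
          rw [← CStarModule.norm_sq_eq A, sq]
      _ = ‖(inner A (T (S y)) y : A)‖ := by rw [h]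
      _ ≤ ‖T (S y)‖ * ‖y‖ := CStarModule.norm_inner_le E
      _ ≤ ‖T‖ * ‖S y‖ * ‖y‖ := by gcongr; exact T.le_opNorm _
      _ = ‖T‖ * ‖y‖ * ‖S y‖ := by ring

/-- An adjointable perturbation of the identity of norm less than one has an adjointable
inverse. -/
theorem IsAdjointable.exists_inverse_one_sub [CompleteSpace E] {T : E →L[ℂ] E}
    (hT : IsAdjointable A T) (h : ‖T‖ < 1) :
    ∃ V : E →L[ℂ] E, IsAdjointable A V ∧ V * (1 - T) = 1 ∧ (1 - T) * V = 1 := by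
  obtain ⟨S, hS⟩ := hT
  obtain ⟨u, hu⟩ := isUnit_one_sub_of_norm_lt_one h
  -- The inverse of `1 - S` will be the adjoint of the inverse of `1 - T`.
  obtain ⟨v, hv⟩ := isUnit_one_sub_of_norm_lt_one ((norm_adjoint_le hS).trans_lt h)
  have hadj : ∀ x y : E, (inner A ((1 - T) x) y : A) = inner A x ((1 - S) y) := fun x y => by
    simp [hS]
  refine ⟨(u⁻¹ : (E →L[ℂ] E)ˣ), ⟨(v⁻¹ : (E →L[ℂ] E)ˣ), fun x y => ?_⟩, ?_, ?_⟩
  · have h1 : (1 - T) ((u⁻¹ : (E →L[ℂ] E)ˣ).1 x) = x := by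
      rw [← hu, ← mul_apply_eq_comp, Units.mul_inv, one_apply_eq_self]
    have h2 : (1 - S) ((v⁻¹ : (E →L[ℂ] E)ˣ).1 y) = y := by
      rw [← hv, ← mul_apply_eq_comp, Units.mul_inv, one_apply_eq_self]
    have h3 := hadj ((u⁻¹ : (E →L[ℂ] E)ˣ).1 x) ((v⁻¹ : (E →L[ℂ] E)ˣ).1 y)
    rw [h1, h2] at h3
    exact h3.symm
  · rw [← hu, Units.inv_mul]
  · rw [← hu, Units.mul_inv]

theorem map_mem_compactOperators {Φ : (E →L[ℂ] E) →L[ℂ] (E →L[ℂ] E)}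
    (hΦ : ∀ x y : E, Φ (rankOne A x y) ∈ compactOperators A (E := E)) {k : E →L[ℂ] E}
    (hk : k ∈ compactOperators A (E := E)) : Φ k ∈ compactOperators A (E := E) := by
  have h1 : compactOperators A (E := E) ≤ (compactOperators A (E := E)).comap
      (Φ : (E →L[ℂ] E) →ₗ[ℂ] (E →L[ℂ] E)) := by
    refine Submodule.topologicalClosure_minimal _ (Submodule.span_le.2 ?_)
      ((Submodule.isClosed_topologicalClosure _).preimage Φ.continuous)
    rintro _ ⟨p, rfl⟩
    exact hΦ p.1 p.2
  exact h1 hk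

theorem rankOne_mem_compactOperators (x y : E) : rankOne A x y ∈ compactOperators A (E := E) :=
  Submodule.le_topologicalClosure _ (Submodule.subset_span ⟨(x, y), rfl⟩)

/-- `T θ_{x,y} = θ_{Tx,y}`; adjointability enters because it makes `T` commute with the action of
`A`. -/
theorem IsAdjointable.mul_mem_compactOperators {T k : E →L[ℂ] E} (hT : IsAdjointable A T)
    (hk : k ∈ compactOperators A (E := E)) : T * k ∈ compactOperators A (E := E) := by
  obtain ⟨S, hS⟩ := hT
  refine map_mem_compactOperators (Φ := ContinuousLinearMap.mul ℂ (E →L[ℂ] E) T) (fun x y => ?_) hk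
  have h : T * rankOne A x y = rankOne A (T x) y := by
    ext z
    refine ext_inner_left (A := A) fun w => ?_
    simp [rankOne_apply, hS, CStarModule.inner_op_smul_left]
  simpa [h] using rankOne_mem_compactOperators (A := A) (T x) y

/-- `θ_{x,y} T = θ_{x,T*y}`. -/
theorem IsAdjointable.compactOperators_mul_mem {T k : E →L[ℂ] E} (hT : IsAdjointable A T)
    (hk : k ∈ compactOperators A (E := E)) : k * T ∈ compactOperators A (E := E) := by
  obtain ⟨S, hS⟩ := hT
  refine map_mem_compactOperators (Φ := (ContinuousLinearMap.mul ℂ (E →L[ℂ] E)).flip T)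
    (fun x y => ?_) hk
  have h : rankOne A x y * T = rankOne A x (S y) := by
    ext z
    have : (inner A y (T z) : A) = inner A (S y) z := by
      rw [← CStarModule.star_inner, hS, CStarModule.star_inner]
    simp [rankOne_apply, this]
  simpa [h] using rankOne_mem_compactOperators (A := A) x (S y)

end BoundedLemmas

/-! ### Graphs of products and closures. -/

section ClosureLemmas

variable {A E : Type*} [NonUnitalCStarAlgebra A] [PartialOrder A] [StarOrderedRing A]
  [NormedAddCommGroup E] [NormedSpace ℂ E] [SMul A E] [CStarModule A E]

theorem mem_graph_ofBounded {T : E →L[ℂ] E} {p : E × E} :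
    p ∈ (ofBounded T).graph ↔ T p.1 = p.2 := by
  rw [LinearPMap.mem_graph_iff]
  constructor
  · rintro ⟨y, h1, h2⟩
    rw [← h1, ← h2]
    rfl
  · intro h
    exact ⟨⟨p.1, Submodule.mem_top⟩, rfl, h⟩

theorem mem_graph_prod {g f : E →ₗ.[ℂ] E} {p : E × E} :
    p ∈ (prod g f).graph ↔ ∃ y, (p.1, y) ∈ f.graph ∧ (y, p.2) ∈ g.graph := by
  constructor
  · intro h
    obtain ⟨x, h1, h2⟩ := (LinearPMap.mem_graph_iff _).1 h
    rw [← h1, ← h2]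
    exact ⟨_, f.mem_graph ⟨x.1, x.2.1⟩, g.mem_graph ⟨_, x.2.2⟩⟩
  · rintro ⟨y, h1, h2⟩
    obtain ⟨x, hx1, rfl⟩ := (LinearPMap.mem_graph_iff _).1 h1
    obtain ⟨z, hz1, hz2⟩ := (LinearPMap.mem_graph_iff _).1 h2
    simp only at hx1 hz1 hz2
    have hz : f x ∈ g.domain := hz1 ▸ z.2
    refine (LinearPMap.mem_graph_iff _).2 ⟨⟨x.1, x.2, hz⟩, hx1, ?_⟩
    rw [← hz2]
    exact congrArg g (Subtype.ext hz1.symm)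

theorem isClosed_ofBounded (T : E →L[ℂ] E) : (ofBounded T).IsClosed := by
  have h : ((ofBounded T).graph : Set (E × E)) = {p | T p.1 = p.2} :=
    Set.ext fun _ => mem_graph_ofBounded
  rw [LinearPMap.IsClosed, h]
  exact isClosed_eq (by fun_prop) (by fun_prop)

/-- A densely defined restriction of a bounded operator is closable, with that bounded operator
as its closure. -/
theorem isClosable_and_closure_eq_ofBounded {u : E →ₗ.[ℂ] E} {T : E →L[ℂ] E} {D : Set E}
    (hD : Dense D) (hDu : ∀ x ∈ D, (x, T x) ∈ u.graph) (hu : ∀ p ∈ u.graph, T p.1 = p.2) :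
    u.IsClosable ∧ u.closure = ofBounded T := by
  have hle : u ≤ ofBounded T :=
    LinearPMap.le_of_le_graph fun p hp => mem_graph_ofBounded.2 (hu p hp)
  have hc : u.IsClosable := (isClosed_ofBounded T).isClosable.leIsClosable hle
  refine ⟨hc, LinearPMap.eq_of_eq_graph ?_⟩
  rw [← hc.graph_closure_eq_closure_graph]
  refine le_antisymm (Submodule.topologicalClosure_minimal _ (LinearPMap.le_graph_of_le hle)
    (isClosed_ofBounded T)) ?_
  rintro ⟨x, y⟩ hp
  obtain rfl : T x = y := mem_graph_ofBounded.1 hp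
  have hcl : IsClosed {x : E | (x, T x) ∈ u.graph.topologicalClosure} :=
    (Submodule.isClosed_topologicalClosure _).preimage (by fun_prop : Continuous fun x => (x, T x))
  have hsub : closure D ⊆ {x : E | (x, T x) ∈ u.graph.topologicalClosure} :=
    closure_minimal (fun x hx => Submodule.le_topologicalClosure _ (hDu x hx)) hcl
  exact hsub (hD x)

theorem apply_eq_of_closure_eq {u : E →ₗ.[ℂ] E} {T : E →L[ℂ] E} (h : u.closure = ofBounded T)
    {p : E × E} (hp : p ∈ u.graph) : T p.1 = p.2 :=
  mem_graph_ofBounded.1 (h ▸ LinearPMap.le_graph_of_le u.le_closure hp)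

/-- The graph of `t G` is the preimage of the closed graph of `t` under `(x, y) ↦ (G x, y)`, so
taking the closure adds nothing: `G` maps all of `E` into `D(t)`. -/
theorem mem_graph_of_closure_prod_eq {t : E →ₗ.[ℂ] E} (ht : t.IsClosed) {G T : E →L[ℂ] E}
    (hc : (prod t (ofBounded G)).IsClosable) (h : (prod t (ofBounded G)).closure = ofBounded T)
    (x : E) : (G x, T x) ∈ t.graph := by
  have hx : (x, T x) ∈ (prod t (ofBounded G)).graph.topologicalClosure := by
    rw [hc.graph_closure_eq_closure_graph, h]
    exact mem_graph_ofBounded.2 rfl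
  have hcl : IsClosed {p : E × E | (G p.1, p.2) ∈ t.graph} :=
    IsClosed.preimage (by fun_prop : Continuous fun p : E × E => (G p.1, p.2)) ht
  have hsub : closure ((prod t (ofBounded G)).graph : Set (E × E)) ⊆
      {p : E × E | (G p.1, p.2) ∈ t.graph} := by
    refine closure_minimal (fun p hp => ?_) hcl
    obtain ⟨y, h1, h2⟩ := mem_graph_prod.1 hp
    obtain rfl : G p.1 = y := mem_graph_ofBounded.1 h1
    exact h2
  exact hsub hx

end ClosureLemmas

/-! ### The resolvent of a selfadjoint regular operator and its dependence on the gap. -/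

section Resolvent

variable {A E : Type*} [NonUnitalCStarAlgebra A] [PartialOrder A] [StarOrderedRing A]
  [NormedAddCommGroup E] [NormedSpace ℂ E] [SMul A E] [CStarModule A E]

theorem inner_symm_of_mem_graph {s : E →ₗ.[ℂ] E} (hd : Dense (s.domain : Set E))
    (hsa : IsSelfadjoint A s) {p q : E × E} (hp : p ∈ s.graph) (hq : q ∈ s.graph) :
    (inner A p.2 q.1 : A) = inner A p.1 q.2 := by
  obtain ⟨x, hx1, hx2⟩ := s.mem_graph_iff.1 hp
  rw [← hsa] at hq
  obtain ⟨y, hy1, hy2⟩ := (LinearPMap.mem_graph_iff _).1 hq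
  rw [← hx1, ← hx2, ← hy1, ← hy2]
  exact mem_adjointGraph_of_mem_domain hd y x

theorem mem_graph_of_inner_symm {s : E →ₗ.[ℂ] E} (hd : Dense (s.domain : Set E))
    (hsa : IsSelfadjoint A s) {q : E × E}
    (h : ∀ p ∈ s.graph, (inner A p.2 q.1 : A) = inner A p.1 q.2) : q ∈ s.graph := by
  rw [← hsa]
  have hmem : q ∈ adjointGraph A s := fun x => h _ (s.mem_graph x)
  have hq : q.1 ∈ (adjoint A s).domain := ⟨q, hmem, rfl⟩
  refine (LinearPMap.mem_graph_iff _).2 ⟨⟨q.1, hq⟩, rfl, ?_⟩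
  -- The value of the adjoint at `q.1` also satisfies the adjoint identity, and density of `D(s)`
  -- forces it to equal `q.2`.
  have h1 := mem_adjointGraph_of_mem_domain (A := A) hd ⟨q.1, hq⟩
  exact eq_of_inner_eq_on_dense (A := A) hd fun z hz =>
    (h1 ⟨z, hz⟩).symm.trans (hmem ⟨z, hz⟩)

variable [CompleteSpace E]

theorem isOrthogonalProjection_graphProjection {s : E →ₗ.[ℂ] E} (hs : IsRegular A s) :
    IsOrthogonalProjection A (graphProjection hs) (graph A s) :=
  hs.exists_graphProjection.choose_spec

/-- The map `(P₁₁, P₂₁)` formed by the first column of an operator matrix `P` on `E ⊕ E`. -/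
noncomputable def firstColumn (P : WithCStarModule A (E × E) →L[ℂ] WithCStarModule A (E × E)) :
    E →L[ℂ] E × E :=
  (WithCStarModule.equivL ℂ (A := A) (E := E × E) : _ →L[ℂ] E × E) ∘L P ∘L
    ((WithCStarModule.equivL ℂ (A := A) (E := E × E)).symm : E × E →L[ℂ] _) ∘L
    ContinuousLinearMap.inl ℂ E E

theorem norm_firstColumn_apply_le
    (P : WithCStarModule A (E × E) →L[ℂ] WithCStarModule A (E × E)) (x : E) :
    ‖firstColumn P x‖ ≤ ‖P‖ * ‖x‖ := by
  let z : WithCStarModule A (E × E) :=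
    (WithCStarModule.equivL ℂ (A := A) (E := E × E)).symm (x, 0)
  have hz : ‖z‖ ≤ ‖x‖ := by
    have := WithCStarModule.prod_norm_le_norm_add z
    have h2 : ‖z.1‖ + ‖z.2‖ = ‖x‖ := by
      change ‖x‖ + ‖(0 : E)‖ = ‖x‖
      simp
    rwa [h2] at this
  calc ‖firstColumn P x‖ ≤ ‖P z‖ := WithCStarModule.norm_equiv_le_norm_prod (P z)
    _ ≤ ‖P‖ * ‖z‖ := P.le_opNorm z
    _ ≤ ‖P‖ * ‖x‖ := by gcongr

/-- The resolvent `(s + i)⁻¹` of a selfadjoint regular operator `s`, written through the first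
column `((1 + s²)⁻¹, s (1 + s²)⁻¹)` of the projection onto the graph. -/
noncomputable def resolvent {s : E →ₗ.[ℂ] E} (hs : IsRegular A s) : E →L[ℂ] E :=
  ContinuousLinearMap.snd ℂ E E ∘L firstColumn (graphProjection hs) -
    I • ContinuousLinearMap.fst ℂ E E ∘L firstColumn (graphProjection hs)

/-- The first column is linear in the projection, and each of its two components contributes at most
the gap. -/
theorem norm_resolvent_sub_le {s t : E →ₗ.[ℂ] E} (hs : IsRegular A s) (ht : IsRegular A t) :
    ‖resolvent hs - resolvent ht‖ ≤ 2 * gap hs ht := by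
  refine ContinuousLinearMap.opNorm_le_bound _ (by unfold gap; positivity) fun x => ?_
  set z := firstColumn (graphProjection hs - graphProjection ht) x with hzdef
  have hz : ‖z‖ ≤ gap hs ht * ‖x‖ := norm_firstColumn_apply_le _ x
  have h1 : (resolvent hs - resolvent ht) x = z.2 - I • z.1 := by
    have h2 : z = firstColumn (graphProjection hs) x - firstColumn (graphProjection ht) x := by
      simp [hzdef, firstColumn]
    simp only [h2, resolvent, sub_apply, smul_apply,
      ContinuousLinearMap.comp_apply, ContinuousLinearMap.coe_fst', ContinuousLinearMap.coe_snd',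
      Prod.fst_sub, Prod.snd_sub, smul_sub]
    abel
  calc ‖(resolvent hs - resolvent ht) x‖ ≤ ‖z.2‖ + ‖I • z.1‖ := by
        rw [h1]; exact norm_sub_le _ _
    _ ≤ ‖z‖ + ‖z‖ := by
        rw [norm_smul, norm_I, one_mul]
        exact add_le_add (norm_snd_le z) (norm_fst_le z)
    _ ≤ 2 * gap hs ht * ‖x‖ := by linarith

section Selfadjoint

variable {s : E →ₗ.[ℂ] E} (hs : IsRegular A s)

theorem firstColumn_mem_graph (x : E) : firstColumn (graphProjection hs) x ∈ s.graph := by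
  have h : graphProjection hs ((WithCStarModule.equivL ℂ (A := A) (E := E × E)).symm (x, 0)) ∈
      graph A s := by
    rw [← (isOrthogonalProjection_graphProjection hs).range_eq]
    exact ⟨_, rfl⟩
  exact h

/-- This is orthogonality of `(x, 0) - P_{G(s)} (x, 0)` to the graph. -/
theorem inner_sub_firstColumn {p : E × E} (hp : p ∈ s.graph) (x : E) :
    (inner A p.2 (firstColumn (graphProjection hs) x).2 : A) =
      inner A p.1 (x - (firstColumn (graphProjection hs) x).1) := by
  have hP := isOrthogonalProjection_graphProjection hs
  let e := WithCStarModule.equivL ℂ (A := A) (E := E × E)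
  have h1 : graphProjection hs (e.symm p) = e.symm p := by
    have h2 : e.symm p ∈ graph A s := hp
    rw [← hP.range_eq] at h2
    obtain ⟨y, hy⟩ := h2
    have hy : graphProjection hs y = e.symm p := hy
    rw [← hy, hP.idem]
  have h3 := hP.symm (e.symm p) (e.symm (x, 0))
  rw [h1] at h3
  have h4 : (inner A p.1 x : A) + inner A p.2 (0 : E) =
      inner A p.1 (firstColumn (graphProjection hs) x).1 +
        inner A p.2 (firstColumn (graphProjection hs) x).2 := h3
  rw [CStarModule.inner_sub_right]
  rw [CStarModule.inner_zero_right, add_zero] at h4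
  rw [h4]
  abel

variable (hsa : IsSelfadjoint A s)
include hsa

/-- Selfadjointness turns orthogonality to the graph into membership. For the first column `(a, c)`
at `x` this gives `s a = c` and `s c = x - a`, that is, `(1 + s²) a = x`. -/
theorem firstColumn_snd_mem_graph (x : E) :
    ((firstColumn (graphProjection hs) x).2, x - (firstColumn (graphProjection hs) x).1) ∈
      s.graph :=
  mem_graph_of_inner_symm hs.dense_domain hsa fun _ hp => inner_sub_firstColumn hs hp x

/-- With `s a = c` and `s c = x - a`, one gets `s (c - i a) = x - i (c - i a)`. -/
theorem resolvent_mem_graph (x : E) :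
    (resolvent hs x, x - I • resolvent hs x) ∈ s.graph := by
  have h := s.graph.sub_mem (firstColumn_snd_mem_graph hs hsa x)
    (s.graph.smul_mem I (firstColumn_mem_graph hs x))
  convert h using 1
  refine Prod.ext rfl ?_
  simp only [resolvent, sub_apply, smul_apply,
    ContinuousLinearMap.comp_apply, ContinuousLinearMap.coe_fst', ContinuousLinearMap.coe_snd',
    Prod.snd_sub, Prod.smul_snd, smul_sub, smul_smul, I_mul_I, neg_smul, one_smul]
  abel

/-- This rests on injectivity of `s + i`: the error `u` satisfies `s u = -i u`, and symmetry of `s`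
then forces `⟨u, u⟩ = 0`. -/
theorem resolvent_apply_of_mem_graph {p : E × E} (hp : p ∈ s.graph) :
    resolvent hs p.2 = p.1 - I • resolvent hs p.1 := by
  set u := resolvent hs (p.2 + I • p.1) - p.1 with hu
  have h1 : (u, -(I • u)) ∈ s.graph := by
    have h := s.graph.sub_mem (resolvent_mem_graph hs hsa (p.2 + I • p.1)) hp
    convert h using 1
    refine Prod.ext rfl ?_
    simp only [hu, Prod.snd_sub, smul_sub]
    abel
  have h2 := inner_symm_of_mem_graph hs.dense_domain hsa h1 h1
  have h3 : (inner A u u : A) = 0 := by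
    simp only [CStarModule.inner_neg_left, CStarModule.inner_neg_right,
      CStarModule.inner_smul_left_complex, CStarModule.inner_smul_right_complex] at h2
    have h4 : (2 * I) • (inner A u u : A) = 0 := by
      have : star I = -I := Complex.conj_I
      rw [this, neg_smul, neg_neg] at h2
      rw [two_mul, add_smul]
      nth_rewrite 1 [h2]
      simp
    exact (smul_eq_zero.1 h4).resolve_left (by simp)
  have h5 := CStarModule.inner_self.1 h3
  rw [hu, map_add, map_smul, sub_eq_zero] at h5
  exact eq_sub_of_add_eq h5

theorem isAdjointable_resolvent : IsAdjointable A (resolvent hs) := by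
  set F := firstColumn (graphProjection hs) with hF
  have hR : ∀ x y : E, (inner A (F x).1 y : A) = inner A x (F y).1 := fun x y => by
    have h1 := inner_sub_firstColumn hs (firstColumn_mem_graph hs x) y
    have h2 := congrArg star (inner_sub_firstColumn hs (firstColumn_mem_graph hs y) x)
    rw [CStarModule.star_inner, CStarModule.star_inner, h1] at h2
    simp only [CStarModule.inner_sub_right, CStarModule.inner_sub_left] at h2
    exact sub_left_injective h2
  have hC : ∀ x y : E, (inner A (F x).2 y : A) = inner A x (F y).2 := fun x y => by
    have h1 := inner_symm_of_mem_graph hs.dense_domain hsa (firstColumn_snd_mem_graph hs hsa x)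
      (firstColumn_snd_mem_graph hs hsa y)
    have h2 := inner_symm_of_mem_graph hs.dense_domain hsa (firstColumn_mem_graph hs x)
      (firstColumn_mem_graph hs y)
    simp only [CStarModule.inner_sub_right, CStarModule.inner_sub_left, ← hF] at h1 h2
    rw [h2] at h1
    exact (sub_left_injective h1).symm
  -- Both entries of the column are symmetric, so the adjoint only changes the sign of `i`; it is
  -- `(s - i)⁻¹`.
  refine ⟨ContinuousLinearMap.snd ℂ E E ∘L F + I • ContinuousLinearMap.fst ℂ E E ∘L F,
    fun x y => ?_⟩
  have hI : star I = -I := Complex.conj_I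
  simp only [resolvent, ← hF, sub_apply, add_apply,
    smul_apply, ContinuousLinearMap.comp_apply, ContinuousLinearMap.coe_fst',
    ContinuousLinearMap.coe_snd', CStarModule.inner_sub_left, CStarModule.inner_add_right,
    CStarModule.inner_smul_left_complex, CStarModule.inner_smul_right_complex, hR, hC, hI,
    neg_smul, sub_neg_eq_add]

end Selfadjoint

end Resolvent

/-! ### Fredholmness as invertibility of `s (s + i)⁻¹` modulo compacts, and its stability. -/

section Fredholm

variable {A E : Type*} [NonUnitalCStarAlgebra A] [PartialOrder A] [StarOrderedRing A]
  [NormedAddCommGroup E] [NormedSpace ℂ E] [CompleteSpace E] [SMul A E] [CStarModule A E]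
  {s : E →ₗ.[ℂ] E} (hs : IsRegular A s) (hsa : IsSelfadjoint A s)
include hsa

/-- If `s` has a pseudo left inverse, then `s (s + i)⁻¹ = 1 - i (s + i)⁻¹` is left invertible
modulo the compact operators. -/
theorem exists_left_inverse_of_isPseudoLeftInverse {G : E →L[ℂ] E}
    (hG : IsPseudoLeftInverse A G s) :
    ∃ X : E →L[ℂ] E, IsAdjointable A X ∧
      X * (1 - I • resolvent hs) - 1 ∈ compactOperators A (E := E) := by
  obtain ⟨hGa, -, T, -, hT, hTk⟩ := hG
  -- With `r = (s + i)⁻¹`, the identity `s r = 1 - i r` gives `G (1 - i r) = T r`, hence `(1 + i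
  -- G)(1 - i r) = 1 + i (T - 1) r`.
  refine ⟨1 + I • G, isAdjointable_one.add (hGa.smul I), ?_⟩
  have h : G * (1 - I • resolvent hs) = T * resolvent hs := by
    ext x
    exact (apply_eq_of_closure_eq hT (p := (resolvent hs x, G (x - I • resolvent hs x)))
      (mem_graph_prod.2 ⟨_, resolvent_mem_graph hs hsa x, mem_graph_ofBounded.2 rfl⟩)).symm
  have h2 : (1 + I • G) * (1 - I • resolvent hs) - 1 = I • ((T - 1) * resolvent hs) := by
    rw [add_mul, one_mul, smul_mul_assoc, h, sub_mul, one_mul, smul_sub]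
    abel
  rw [h2]
  exact Submodule.smul_mem _ _ ((isAdjointable_resolvent hs hsa).compactOperators_mul_mem hTk)

/-- The same witness works on the right: `G` maps into `D(s)`, where `r s = 1 - i r`, so `(1 - i r)
G = r T`. -/
theorem exists_right_inverse_of_isPseudoRightInverse {G : E →L[ℂ] E}
    (hG : IsPseudoRightInverse A G s) :
    ∃ X : E →L[ℂ] E, IsAdjointable A X ∧
      (1 - I • resolvent hs) * X - 1 ∈ compactOperators A (E := E) := by
  obtain ⟨hGa, hc, T, -, hT, hTk⟩ := hG
  refine ⟨1 + I • G, isAdjointable_one.add (hGa.smul I), ?_⟩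
  have h : (1 - I • resolvent hs) * G = resolvent hs * T := by
    ext x
    exact (resolvent_apply_of_mem_graph hs hsa
      (mem_graph_of_closure_prod_eq hs.closed hc hT x)).symm
  have h2 : (1 - I • resolvent hs) * (1 + I • G) - 1 = I • (resolvent hs * (T - 1)) := by
    rw [mul_add, mul_one, mul_smul_comm, h, mul_sub, mul_one, smul_sub]
    abel
  rw [h2]
  exact Submodule.smul_mem _ _ ((isAdjointable_resolvent hs hsa).mul_mem_compactOperators hTk)

/-- On `D(s)`, `Y r s` agrees with the bounded operator `Y (1 - i r)`, which is therefore the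
closure. -/
theorem isPseudoLeftInverse_mul_resolvent {Y : E →L[ℂ] E} (hY : IsAdjointable A Y)
    (hYk : Y * (1 - I • resolvent hs) - 1 ∈ compactOperators A (E := E)) :
    IsPseudoLeftInverse A (Y * resolvent hs) s := by
  have hr := isAdjointable_resolvent hs hsa
  have key : ∀ p ∈ s.graph, (Y * (1 - I • resolvent hs)) p.1 = (Y * resolvent hs) p.2 :=
    fun p hp => congrArg Y (resolvent_apply_of_mem_graph hs hsa hp).symm
  obtain ⟨h1, h2⟩ := isClosable_and_closure_eq_ofBounded
    (u := prod (ofBounded (Y * resolvent hs)) s) (T := Y * (1 - I • resolvent hs))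
    hs.dense_domain
    (fun x hx => mem_graph_prod.2 ⟨_, s.mem_graph ⟨x, hx⟩,
      mem_graph_ofBounded.2 (key _ (s.mem_graph ⟨x, hx⟩)).symm⟩)
    (fun p hp => by
      obtain ⟨y, hy, hy'⟩ := mem_graph_prod.1 hp
      exact (key _ hy).trans (mem_graph_ofBounded.1 hy'))
  exact ⟨hY.mul hr, h1, _, hY.mul (isAdjointable_one.sub (hr.smul I)), h2, hYk⟩

/-- The range of `r` lies in `D(s)`, so `s r Y = (1 - i r) Y` holds on all of `E`. -/
theorem isPseudoRightInverse_resolvent_mul {Y : E →L[ℂ] E} (hY : IsAdjointable A Y)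
    (hYk : (1 - I • resolvent hs) * Y - 1 ∈ compactOperators A (E := E)) :
    IsPseudoRightInverse A (resolvent hs * Y) s := by
  have hr := isAdjointable_resolvent hs hsa
  have key : ∀ x, ((resolvent hs * Y) x, ((1 - I • resolvent hs) * Y) x) ∈ s.graph :=
    fun x => resolvent_mem_graph hs hsa (Y x)
  obtain ⟨h1, h2⟩ := isClosable_and_closure_eq_ofBounded
    (u := prod s (ofBounded (resolvent hs * Y))) (T := (1 - I • resolvent hs) * Y)
    dense_univ
    (fun x _ => mem_graph_prod.2 ⟨_, mem_graph_ofBounded.2 rfl, key x⟩)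
    (fun p hp => by
      obtain ⟨y, hy, hy'⟩ := mem_graph_prod.1 hp
      exact s.mem_graph_snd_inj (key p.1) hy' (mem_graph_ofBounded.1 hy))
  exact ⟨hr.mul hY, h1, _, (isAdjointable_one.sub (hr.smul I)).mul hY, h2, hYk⟩

omit hsa

/-- `X C = (1 - X (B - C)) + (X B - 1)` is an invertible operator plus a compact one; multiplying by
the inverse `V` leaves `1` plus a compact operator. -/
theorem exists_left_inverse_of_norm_sub_lt {X B C : E →L[ℂ] E} (hX : IsAdjointable A X)
    (hB : IsAdjointable A B) (hC : IsAdjointable A C) (hlt : ‖X‖ * ‖B - C‖ < 1)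
    (hXk : X * B - 1 ∈ compactOperators A (E := E)) :
    ∃ Y : E →L[ℂ] E, IsAdjointable A Y ∧ Y * C - 1 ∈ compactOperators A (E := E) := by
  obtain ⟨V, hV, hV1, -⟩ := (hX.mul (hB.sub hC)).exists_inverse_one_sub
    ((norm_mul_le _ _).trans_lt hlt)
  refine ⟨V * X, hV.mul hX, ?_⟩
  have h : V * X * C - 1 = V * (X * B - 1) := by
    calc V * X * C - 1 = V * X * C - V * (1 - X * (B - C)) := by rw [hV1]
      _ = V * (X * B - 1) := by noncomm_ring
  rw [h]
  exact hV.mul_mem_compactOperators hXk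

theorem exists_right_inverse_of_norm_sub_lt {X B C : E →L[ℂ] E} (hX : IsAdjointable A X)
    (hB : IsAdjointable A B) (hC : IsAdjointable A C) (hlt : ‖X‖ * ‖B - C‖ < 1)
    (hXk : B * X - 1 ∈ compactOperators A (E := E)) :
    ∃ Y : E →L[ℂ] E, IsAdjointable A Y ∧ C * Y - 1 ∈ compactOperators A (E := E) := by
  obtain ⟨V, hV, -, hV1⟩ := ((hB.sub hC).mul hX).exists_inverse_one_sub
    ((norm_mul_le _ _).trans_lt (by rwa [mul_comm]))
  refine ⟨X * V, hX.mul hV, ?_⟩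
  have h : C * (X * V) - 1 = (B * X - 1) * V := by
    calc C * (X * V) - 1 = C * (X * V) - (1 - (B - C) * X) * V := by rw [hV1]
      _ = (B * X - 1) * V := by noncomm_ring
  rw [h]
  exact hV.compactOperators_mul_mem hXk

end Fredholm

end HilbertModule

theorem mainTheorem8 {A E : Type*} [NonUnitalCStarAlgebra A] [PartialOrder A] [StarOrderedRing A]
    [NormedAddCommGroup E] [NormedSpace ℂ E] [CompleteSpace E] [SMul A E] [CStarModule A E]
    (t : E →ₗ.[ℂ] E) (ht : HilbertModule.IsRegular A t)
    (htsa : HilbertModule.IsSelfadjoint A t) (htF : HilbertModule.IsFredholm A t) :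
    ∃ r : ℝ, 0 < r ∧ ∀ (s : E →ₗ.[ℂ] E) (hs : HilbertModule.IsRegular A s),
      HilbertModule.IsSelfadjoint A s → HilbertModule.gap hs ht ≤ r →
        HilbertModule.IsFredholm A s := by
  open HilbertModule in
  obtain ⟨⟨G, hG⟩, G', hG'⟩ := htF
  obtain ⟨X, hX, hXk⟩ := exists_left_inverse_of_isPseudoLeftInverse ht htsa hG
  obtain ⟨X', hX', hXk'⟩ := exists_right_inverse_of_isPseudoRightInverse ht htsa hG'
  -- The 2 absorbs the Lipschitz constant of the resolvent. The sum serves both one-sided inverses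
  -- at once, and the `+ 1` makes the Neumann bound strict.
  refine ⟨1 / (2 * (‖X‖ + ‖X'‖ + 1)), by positivity, fun s hs hssa hgap => ?_⟩
  have hBt := (isAdjointable_one (A := A)).sub ((isAdjointable_resolvent ht htsa).smul Complex.I)
  have hBs := (isAdjointable_one (A := A)).sub ((isAdjointable_resolvent hs hssa).smul Complex.I)
  have hdiff : ‖(1 - Complex.I • resolvent ht) - (1 - Complex.I • resolvent hs)‖ ≤
      1 / (‖X‖ + ‖X'‖ + 1) := by
    rw [sub_sub_sub_cancel_left, ← smul_sub, norm_smul, Complex.norm_I, one_mul]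
    calc _ ≤ 2 * gap hs ht := norm_resolvent_sub_le hs ht
      _ ≤ 2 * (1 / (2 * (‖X‖ + ‖X'‖ + 1))) := by gcongr
      _ = 1 / (‖X‖ + ‖X'‖ + 1) := by field_simp
  have hlt : ∀ c : ℝ, 0 ≤ c → c ≤ ‖X‖ + ‖X'‖ →
      c * ‖(1 - Complex.I • resolvent ht) - (1 - Complex.I • resolvent hs)‖ < 1 := by
    intro c hc0 hc
    refine (mul_le_mul_of_nonneg_left hdiff hc0).trans_lt ?_
    rw [mul_one_div, div_lt_one (by positivity)]
    linarith
  obtain ⟨Y, hY, hYk⟩ := exists_left_inverse_of_norm_sub_lt hX hBt hBs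
    (hlt _ (norm_nonneg _) (by linarith [norm_nonneg X'])) hXk
  obtain ⟨Y', hY', hYk'⟩ := exists_right_inverse_of_norm_sub_lt hX' hBt hBs
    (hlt _ (norm_nonneg _) (by linarith [norm_nonneg X])) hXk'
  exact ⟨⟨_, isPseudoLeftInverse_mul_resolvent hs hssa hY hYk⟩,
    _, isPseudoRightInverse_resolvent_mul hs hssa hY' hYk'⟩
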